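/- A rooted tree is a finite nonempty tree $T$ with a distinguished root vertex; its size is its number of vertices. A vertex $u$ is an ancestor of $v$ if $u$ lies on the path from $v$ to the root (so $v$ is an ancestor of itself), and $\mathrm{nca}_T(u,v)$ denotes the common ancestor of $u$ and $v$ that is furthest from the root. A rooted tree is binary if every vertex has at most two children. A rooted tree $S$ is NCA-universal for a family $\mathcal{F}$ of rooted trees if for every $T\in\mathcal{F}$ there is an injective map $\varphi_T\colon V(T)\to V(S)$ such that $\varphi_T(\mathrm{nca}_T(u,v))=\mathrm{nca}_S(\varphi_T(u),\varphi_T(v))$ for all $u,v\in V(T)$ (the root of $T$ need not be mapped to the root of $S$). Theorem. Let $n\ge 2$ be an integer. Then: 1. There is a rooted tree $S_n$ of size less than $n^{2.318}$ that is NCA-universal for the family $\mathcal{T}_n$ of all rooted trees with at most $n$ vertices. 2. There is a rooted tree $S_n^{\mathrm{bin}}$ of size less than $n^{1.894}$ that is NCA-universal for the family $\mathcal{B}_n$ of all rooted binary trees with at most $n$ vertices. -/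

import Mathlib

universe u v

namespace RootedTree

/- Mathlib's `RootedTree` is a type of vertices with the ancestor order: `a ≤ b` means that `a` is
an ancestor of `b` (every vertex is an ancestor of itself), `⊥` is the root, `Order.pred` is the
parent, and `c` is a child of `a` iff `a ⋖ c`. The ancestors of a vertex form a finite chain
starting at the root, so of two common ancestors the larger one is the one further from the root. -/

/-- The nearest common ancestor of `a` and `b`: the common ancestor furthest from the root, that is,
the greatest element of `{w | w ≤ a ∧ w ≤ b}`. -/
def nca (T : RootedTree.{u}) (a b : T) : T := a ⊓ b

theorem isGreatest_nca (T : RootedTree.{u}) (a b : T) :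
    IsGreatest {w : T | w ≤ a ∧ w ≤ b} (T.nca a b) :=
  ⟨⟨inf_le_left, inf_le_right⟩, fun _ hw => le_inf hw.1 hw.2⟩

/-- A rooted tree is binary if every vertex has at most two children. -/
def IsBinary (T : RootedTree.{u}) : Prop :=
  ∀ a : T, {c : T | a ⋖ c}.encard ≤ 2

/-- The family of (finite) rooted trees with at most `n` vertices. -/
def trees (n : ℕ) : Set RootedTree.{u} :=
  {T | Finite T ∧ Nat.card T ≤ n}

/-- The family of (finite) rooted binary trees with at most `n` vertices. -/
def binaryTrees (n : ℕ) : Set RootedTree.{u} :=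
  {T | Finite T ∧ Nat.card T ≤ n ∧ T.IsBinary}

/-- `S` is NCA-universal for the family `F`: every tree of the family has an injective map into
`S` that commutes with the NCA function. -/
def IsNCAUniversal (S : RootedTree.{v}) (F : Set RootedTree.{u}) : Prop :=
  ∀ T ∈ F, ∃ φ : T → S, Function.Injective φ ∧
    ∀ a b : T, φ (T.nca a b) = S.nca (φ a) (φ b)

end RootedTree

open Set

namespace RootedTree

/-! Hosts are built by strong induction on `n`, aiming at size at most `n ^ c`. In a guest subtree
of size at most `n`, set `k = ⌊a n⌋` and descend to a last vertex `e` for which the path to it and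
everything branching off that path weigh at most `k`. Each child of `e` then has size at most `n - k
- 1`. The `j`-th largest child (from `j = 1`) also has size at most `(n - 1) / j`, so joining
smaller hosts of these sizes under a root hosts the subtree at `e` (`EmbedsAt.graft_of_children`).
The path above `e` is added by `exists_spine`: it is split at half its weight, the middle vertex
becomes a root carrying hosts for its side branches, and both halves are treated recursively. This
costs at most `K * k ^ c`, where `B + 2 * K * 2 ^ (-c) ≤ K` and `B` bounds `∑ j ^ (-c)`. With `A`
bounding the same sum from `j = 2`, the induction closes in `exists_universal` when `(1 - a) ^ c + A
+ K * a ^ c < 1`. For binary trees `A` bounds `2 ^ (-c)` and `B = 1`; for all trees `A` and `B`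
bound `ζ(c) - 1` and `ζ(c)`. -/

/-- The number of descendants of a vertex, the vertex itself included. -/
noncomputable def size {T : RootedTree.{u}} (v : T) : ℕ := (Ici v).ncard

/-! ### Branching and subtree sizes in the guest tree -/

section Guest

variable {T : RootedTree.{u}}

theorem eq_of_covBy_of_le {v c c' a : T} (hc : v ⋖ c) (hc' : v ⋖ c') (ha : c ≤ a) (ha' : c' ≤ a) :
    c = c' := by
  rcases le_total_of_directed ha ha' with h | h
  swap
  · exact (hc'.eq_or_eq hc.le h).resolve_left hc.lt.ne'
  · exact ((hc.eq_or_eq hc'.le h).resolve_left hc'.lt.ne').symm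

/-- Ancestors of a vertex form a chain, so an infimum strictly below `v` in the tree would lie in
both branches and force `c = c'`. -/
theorem inf_eq_of_covBy {v c c' a b : T} (hc : v ⋖ c) (hc' : v ⋖ c') (ha : c ≤ a) (hb : c' ≤ b)
    (hne : c ≠ c') : a ⊓ b = v := by
  by_contra h
  have hv : v ≤ a ⊓ b := le_inf (hc.le.trans ha) (hc'.le.trans hb)
  have key : ∀ {x y : T}, v ⋖ x → x ≤ y → a ⊓ b ≤ y → x ≤ a ⊓ b := by
    intro x y hx hxy hy
    rcases le_total_of_directed hxy hy with h' | h'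
    swap
    · exact h'
    · rcases hx.eq_or_eq hv h' with h'' | h''
      · exact absurd h'' h
      · exact h''.ge
  exact hne (eq_of_covBy_of_le hc hc' (key hc ha inf_le_left) (key hc' hb inf_le_right))

variable [Finite T]

theorem exists_child_le {v a : T} (h : v < a) : ∃ c, v ⋖ c ∧ c ≤ a :=
  h.exists_covby_le

theorem size_pos (v : T) : 0 < size v :=
  (Set.ncard_pos).2 ⟨v, le_rfl⟩

theorem size_anti {v w : T} (h : v ≤ w) : size w ≤ size v :=
  Set.ncard_le_ncard (Ici_subset_Ici.2 h)

theorem size_lt_of_lt {v w : T} (h : v < w) : size w < size v :=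
  Set.ncard_lt_ncard (Ici_ssubset_Ici.2 h)

/-- The subtrees of distinct children are disjoint. -/
theorem sum_size_lt (v : T) (C : Finset T) (hC : ∀ c ∈ C, v ⋖ c) :
    ∑ c ∈ C, size c < size v := by
  classical
  have h1 : ∑ c ∈ C, size c = (C.biUnion fun c => (Ici c).toFinite.toFinset).card := by
    rw [Finset.card_biUnion]
    · exact Finset.sum_congr rfl fun c _ => Set.ncard_eq_toFinset_card _
    · intro c hc c' hc' hne
      rw [Function.onFun, Finset.disjoint_left]
      intro a ha ha'
      exact hne (eq_of_covBy_of_le (hC c hc) (hC c' hc') (by simpa using ha) (by simpa using ha'))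
  rw [h1, ← Set.ncard_coe_finset]
  refine Set.ncard_lt_ncard ?_ (Set.toFinite _)
  rw [Set.ssubset_iff_of_subset]
  · refine ⟨v, le_rfl, ?_⟩
    simp only [Finset.coe_biUnion, Finite.coe_toFinset, mem_iUnion, mem_Ici, not_exists]
    intro c hc hle
    exact (hC c hc).lt.not_ge hle
  · intro a ha
    simp only [Finset.coe_biUnion, Finite.coe_toFinset, mem_iUnion, mem_Ici] at ha
    obtain ⟨c, hc, hle⟩ := ha
    exact (hC c hc).le.trans hle

end Guest

/-- Ranking the elements of a finite set by decreasing weight, the `i`-th one has weight at most the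
`i`-th part of the total. -/
theorem exists_rank {α : Type*} (C : Finset α) (w : α → ℕ) :
    ∃ σ : α → ℕ, InjOn σ C ∧ ∀ c ∈ C, σ c < C.card ∧ (σ c + 1) * w c ≤ ∑ x ∈ C, w x := by
  classical
  induction hk : C.card generalizing C with
  | zero =>
    obtain rfl := Finset.card_eq_zero.1 hk
    exact ⟨fun _ => 0, by simp, by simp⟩
  | succ k ih =>
    have hne : C.Nonempty := Finset.card_pos.1 (by omega)
    -- The lightest element gets the last rank `k`: `k + 1` copies of its weight are at most the
    -- total.
    obtain ⟨a, ha, hmin⟩ := Finset.exists_min_image C w hne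
    obtain ⟨σ, hσ, hσ'⟩ := ih (C.erase a) (by rw [Finset.card_erase_of_mem ha]; omega)
    refine ⟨Function.update σ a k, ?_, ?_⟩
    · intro x hx y hy hxy
      by_cases hxa : x = a <;> by_cases hya : y = a
      · rw [hxa, hya]
      · rw [hxa, Function.update_self, Function.update_of_ne hya] at hxy
        have := (hσ' y (Finset.mem_erase.2 ⟨hya, hy⟩)).1
        omega
      · rw [hya, Function.update_self, Function.update_of_ne hxa] at hxy
        have := (hσ' x (Finset.mem_erase.2 ⟨hxa, hx⟩)).1
        omega
      · rw [Function.update_of_ne hxa, Function.update_of_ne hya] at hxy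
        exact hσ (Finset.mem_coe.2 (Finset.mem_erase.2 ⟨hxa, hx⟩))
          (Finset.mem_coe.2 (Finset.mem_erase.2 ⟨hya, hy⟩)) hxy
    · intro c hc
      by_cases hca : c = a
      · rw [hca, Function.update_self]
        refine ⟨by omega, ?_⟩
        have := Finset.card_nsmul_le_sum C w (w a) hmin
        rwa [hk, smul_eq_mul] at this
      · rw [Function.update_of_ne hca]
        have := hσ' c (Finset.mem_erase.2 ⟨hca, hc⟩)
        exact ⟨by omega, this.2.trans
          (Finset.sum_le_sum_of_subset (Finset.erase_subset a C))⟩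

/-! ### Joining trees under a new root -/

section Graft

variable {ι : Type} (S : ι → RootedTree.{0})

/-- The vertices of the tree obtained by joining the trees `S i` under a new root. -/
abbrev Graft : Type := WithBot (Σ i, S i)

open Classical in
/-- The infimum of the tree obtained by joining the trees `S i` under a new root. -/
noncomputable def graftInf : Graft S → Graft S → Graft S
  | some ⟨i, x⟩, some ⟨j, y⟩ => if h : i = j then some ⟨j, (h ▸ x) ⊓ y⟩ else ⊥
  | _, _ => ⊥

theorem graft_coe_le {i : ι} {x y : S i} :
    ((⟨i, x⟩ : Σ i, S i) : Graft S) ≤ ((⟨i, y⟩ : Σ i, S i) : Graft S) ↔ x ≤ y := by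
  rw [WithBot.coe_le_coe, Sigma.mk_le_mk_iff]

theorem graft_fst_eq {i j : ι} {x : S i} {y : S j}
    (h : ((⟨i, x⟩ : Σ i, S i) : Graft S) ≤ ((⟨j, y⟩ : Σ i, S i) : Graft S)) : i = j := by
  rw [WithBot.coe_le_coe, Sigma.le_def] at h
  exact h.1

theorem graftInf_self (i : ι) (x y : S i) :
    graftInf S ((⟨i, x⟩ : Σ i, S i) : Graft S) ((⟨i, y⟩ : Σ i, S i) : Graft S) =
      ((⟨i, x ⊓ y⟩ : Σ i, S i) : Graft S) :=
  dif_pos rfl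

theorem graftInf_of_ne {i j : ι} (h : i ≠ j) (x : S i) (y : S j) :
    graftInf S ((⟨i, x⟩ : Σ i, S i) : Graft S) ((⟨j, y⟩ : Σ i, S i) : Graft S) = ⊥ :=
  dif_neg h

theorem graftInf_bot_right (a : Graft S) : graftInf S a ⊥ = ⊥ := by
  cases a <;> rfl

noncomputable instance : SemilatticeInf (Graft S) where
  inf := graftInf S
  inf_le_left a b := by
    induction a using WithBot.recBotCoe with
    | bot => exact bot_le
    | coe a =>
      induction b using WithBot.recBotCoe with
      | bot => rw [graftInf_bot_right]; exact bot_le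
      | coe b =>
        obtain ⟨i, x⟩ := a
        obtain ⟨j, y⟩ := b
        by_cases h : i = j
        · subst h
          rw [graftInf_self, graft_coe_le]
          exact inf_le_left
        · rw [graftInf_of_ne S h]
          exact bot_le
  inf_le_right a b := by
    induction a using WithBot.recBotCoe with
    | bot => exact bot_le
    | coe a =>
      induction b using WithBot.recBotCoe with
      | bot => rw [graftInf_bot_right]
      | coe b =>
        obtain ⟨i, x⟩ := a
        obtain ⟨j, y⟩ := b
        by_cases h : i = j
        · subst h
          rw [graftInf_self, graft_coe_le]
          exact inf_le_right
        · rw [graftInf_of_ne S h]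
          exact bot_le
  le_inf a b c hab hac := by
    induction a using WithBot.recBotCoe with
    | bot => exact bot_le
    | coe a =>
      induction b using WithBot.recBotCoe with
      | bot => exact absurd hab (WithBot.not_coe_le_bot a)
      | coe b =>
        induction c using WithBot.recBotCoe with
        | bot => exact absurd hac (WithBot.not_coe_le_bot a)
        | coe c =>
          obtain ⟨i, x⟩ := a
          obtain ⟨j, y⟩ := b
          obtain ⟨k, z⟩ := c
          obtain rfl := graft_fst_eq S hab
          obtain rfl := graft_fst_eq S hac
          rw [graftInf_self, graft_coe_le]
          exact le_inf ((graft_coe_le S).1 hab) ((graft_coe_le S).1 hac)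

open Classical in
/-- The parent function of the tree obtained by joining the trees `S i` under a new root. -/
noncomputable def graftPred : Graft S → Graft S
  | some ⟨i, x⟩ => if x = ⊥ then ⊥ else some ⟨i, Order.pred x⟩
  | none => ⊥

theorem graftPred_bot (i : ι) : graftPred S ((⟨i, ⊥⟩ : Σ i, S i) : Graft S) = ⊥ :=
  if_pos rfl

theorem graftPred_of_ne {i : ι} {x : S i} (h : x ≠ ⊥) :
    graftPred S ((⟨i, x⟩ : Σ i, S i) : Graft S) = ((⟨i, Order.pred x⟩ : Σ i, S i) : Graft S) :=
  if_neg h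

noncomputable instance : PredOrder (Graft S) where
  pred := graftPred S
  pred_le a := by
    induction a using WithBot.recBotCoe with
    | bot => exact bot_le
    | coe a =>
      obtain ⟨i, x⟩ := a
      by_cases h : x = ⊥
      · subst h
        rw [graftPred_bot]
        exact bot_le
      · rw [graftPred_of_ne S h, graft_coe_le]
        exact Order.pred_le x
  min_of_le_pred {a} ha := by
    induction a using WithBot.recBotCoe with
    | bot => exact isMin_bot
    | coe a =>
      obtain ⟨i, x⟩ := a
      by_cases h : x = ⊥
      · subst h
        rw [graftPred_bot] at ha
        exact absurd ha (WithBot.not_coe_le_bot _)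
      · rw [graftPred_of_ne S h, graft_coe_le] at ha
        exact absurd (Order.min_of_le_pred ha).eq_bot h
  le_pred_of_lt {a b} hab := by
    induction a using WithBot.recBotCoe with
    | bot => exact bot_le
    | coe a =>
      induction b using WithBot.recBotCoe with
      | bot => exact absurd hab.le (WithBot.not_coe_le_bot a)
      | coe b =>
        obtain ⟨i, x⟩ := a
        obtain ⟨j, y⟩ := b
        obtain rfl := graft_fst_eq S hab.le
        have hxy : x < y := by
          refine lt_of_le_not_ge ((graft_coe_le S).1 hab.le) fun h => ?_
          exact hab.not_ge ((graft_coe_le S).2 h)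
        rw [graftPred_of_ne S hxy.ne_bot, graft_coe_le]
        exact Order.le_pred_of_lt hxy

variable [Finite ι] [∀ i, Finite (S i)]

instance : Finite (Graft S) := inferInstanceAs (Finite (Option (Σ i, S i)))

/-- The tree obtained by joining finitely many finite trees `S i` under a new root. -/
noncomputable def graft : RootedTree.{0} where
  α := Graft S

instance : Finite (graft S) := inferInstanceAs (Finite (Graft S))

/-- The inclusion of one of the joined trees. -/
def graftMk (i : ι) (x : S i) : graft S := ((⟨i, x⟩ : Σ i, S i) : Graft S)

theorem graftMk_inf (i : ι) (x y : S i) :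
    graftMk S i x ⊓ graftMk S i y = graftMk S i (x ⊓ y) := graftInf_self S i x y

theorem graftMk_inf_of_ne {i j : ι} (h : i ≠ j) (x : S i) (y : S j) :
    graftMk S i x ⊓ graftMk S j y = ⊥ := graftInf_of_ne S h x y

theorem graftMk_injective (i : ι) : Function.Injective (graftMk S i) := by
  intro x y h
  exact le_antisymm ((graft_coe_le S).1 (le_of_eq h)) ((graft_coe_le S).1 (ge_of_eq h))

theorem graftMk_fst {i j : ι} {x : S i} {y : S j} (h : graftMk S i x = graftMk S j y) : i = j :=
  graft_fst_eq S (le_of_eq h)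

theorem graftMk_ne_bot (i : ι) (x : S i) : graftMk S i x ≠ ⊥ :=
  WithBot.coe_ne_bot

theorem card_graft {ι : Type} [Fintype ι] (S : ι → RootedTree.{0}) [∀ i, Finite (S i)] :
    Nat.card (graft S) = 1 + ∑ i, Nat.card (S i) := by
  change Nat.card (Option (Σ i, S i)) = _
  rw [Finite.card_option, Nat.card_sigma, add_comm]

end Graft

/-! ### Embedding a subtree into a host -/

/-- The subtree of `T` at `v` has an injective map into `S` that commutes with the NCA function. -/
def EmbedsAt {T : RootedTree.{u}} (v : T) (S : RootedTree.{0}) : Prop :=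
  ∃ φ : T → S, InjOn φ (Ici v) ∧ ∀ a b : T, v ≤ a → v ≤ b → φ (a ⊓ b) = φ a ⊓ φ b

section Embed

variable {T : RootedTree.{u}} {ι : Type} (S : ι → RootedTree.{0}) [Finite ι] [∀ i, Finite (S i)]

theorem EmbedsAt.graft {v : T} {i : ι} (h : EmbedsAt v (S i)) : EmbedsAt v (graft S) := by
  obtain ⟨φ, hinj, hφ⟩ := h
  refine ⟨fun a => graftMk S i (φ a), fun a ha b hb hab => ?_, fun a b ha hb => ?_⟩
  · exact hinj ha hb (graftMk_injective S i hab)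
  · simp only [graftMk_inf, hφ a b ha hb]

/-- The vertex `v` goes to the new root and each child's subtree to its own component. Since `σ` is
injective, vertices below different children meet at the root, as they do in `T`. -/
theorem EmbedsAt.graft_of_children [Finite T] {v : T} (σ : {c : T // v ⋖ c} → ι)
    (hσ : Function.Injective σ) (h : ∀ c : {c : T // v ⋖ c}, EmbedsAt c.1 (S (σ c))) :
    EmbedsAt v (RootedTree.graft S) := by
  classical
  choose φ hinj hφ using h
  have hch : ∀ a : T, v < a → ∃ c : {c : T // v ⋖ c}, c.1 ≤ a := fun a ha => by
    obtain ⟨c, hc, hle⟩ := exists_child_le ha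
    exact ⟨⟨c, hc⟩, hle⟩
  choose κ hκ using hch
  let ψ : T → RootedTree.graft S := fun a =>
    if ha : v < a then graftMk S (σ (κ a ha)) (φ (κ a ha) a) else ⊥
  have hψ : ∀ (c : {c : T // v ⋖ c}) (a : T), c.1 ≤ a → ψ a = graftMk S (σ c) (φ c a) := by
    intro c a hca
    have hva : v < a := c.2.lt.trans_le hca
    have : κ a hva = c := Subtype.ext (eq_of_covBy_of_le (κ a hva).2 c.2 (hκ a hva) hca)
    subst this
    exact dif_pos hva
  have hψv : ψ v = ⊥ := dif_neg (lt_irrefl v)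
  refine ⟨ψ, fun a ha b hb hab => ?_, fun a b ha hb => ?_⟩
  · rcases (mem_Ici.1 ha).eq_or_lt with rfl | ha <;> rcases (mem_Ici.1 hb).eq_or_lt with rfl | hb
    · rfl
    · rw [hψv, hψ _ b (hκ b hb)] at hab
      exact absurd hab.symm (graftMk_ne_bot S _ _)
    · rw [hψv, hψ _ a (hκ a ha)] at hab
      exact absurd hab (graftMk_ne_bot S _ _)
    · rw [hψ _ b (hκ b hb), hψ _ a (hκ a ha)] at hab
      have hc : κ a ha = κ b hb := hσ (graftMk_fst S hab)
      have hb' : (κ a ha).1 ≤ b := hc ▸ hκ b hb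
      rw [← hc] at hab
      exact hinj _ (hκ a ha) hb' (graftMk_injective S _ hab)
  · rcases ha.eq_or_lt with rfl | ha'
    · rw [inf_eq_left.2 hb, hψv, bot_inf_eq]
    rcases hb.eq_or_lt with rfl | hb'
    · rw [inf_eq_right.2 ha, hψv, inf_bot_eq]
    by_cases hc : κ a ha' = κ b hb'
    · have hb'' : (κ a ha').1 ≤ b := hc ▸ hκ b hb'
      rw [hψ (κ a ha') a (hκ a ha'), hψ (κ a ha') b hb'',
        hψ (κ a ha') (a ⊓ b) (le_inf (hκ a ha') hb''), graftMk_inf, hφ _ a b (hκ a ha') hb'']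
    · rw [inf_eq_of_covBy (κ a ha').2 (κ b hb').2 (hκ a ha') (hκ b hb')
        (fun h => hc (Subtype.ext h)), hψv, hψ _ a (hκ a ha'), hψ _ b (hκ b hb'),
        graftMk_inf_of_ne S (fun h => hc (hσ h))]

end Embed

/-- Every vertex of `T` has at most `d` children. -/
def MaxChildren (T : RootedTree.{u}) (d : ℕ) : Prop :=
  ∀ a : T, {c : T | a ⋖ c}.encard ≤ d

theorem MaxChildren.card_le {T : RootedTree.{u}} {d : ℕ} (hT : T.MaxChildren d) (v : T)
    (C : Finset T) (hC : ∀ c ∈ C, v ⋖ c) : C.card ≤ d := by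
  have h1 : (C : Set T).encard ≤ {c : T | v ⋖ c}.encard := Set.encard_le_encard fun c hc => hC c hc
  rw [Set.encard_coe_eq_coe_finsetCard] at h1
  exact_mod_cast h1.trans (hT v)

/-! ### Ranking the children of a vertex by subtree size -/

section Rank

variable {T : RootedTree.{u}} [Finite T]

/-- Subtrees are nonempty, so ranks stay below `m`; hence `m / (σ c + 1)` is positive and indexes a
genuine host. -/
theorem exists_rank_children {m : ℕ} (C : Finset T) (hC : ∑ c ∈ C, size c ≤ m) :
    ∃ σ : T → ℕ, InjOn σ C ∧ ∀ c ∈ C, σ c < min m C.card ∧ size c ≤ m / (σ c + 1) := by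
  obtain ⟨σ, hσ, h⟩ := exists_rank C (size : T → ℕ)
  refine ⟨σ, hσ, fun c hc => ?_⟩
  obtain ⟨h1, h2⟩ := h c hc
  have h3 : (σ c + 1) * size c ≤ m := h2.trans hC
  have h4 : σ c + 1 ≤ (σ c + 1) * size c := Nat.le_mul_of_pos_right _ (size_pos c)
  refine ⟨lt_min (by omega) h1, ?_⟩
  rw [Nat.le_div_iff_mul_le (Nat.succ_pos _), mul_comm]
  exact h3

theorem MaxChildren.exists_rank {d m : ℕ} (hT : T.MaxChildren d) {v : T} (hv : size v ≤ m + 1) :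
    ∃ σ : {c : T // v ⋖ c} → Fin (min m d), Function.Injective σ ∧
      ∀ c, size c.1 ≤ m / (σ c + 1) := by
  classical
  let C : Finset T := {c : T | v ⋖ c}.toFinite.toFinset
  have hC : ∀ c, c ∈ C ↔ v ⋖ c := fun c => by simp [C]
  have hs := sum_size_lt v C fun c hc => (hC c).1 hc
  obtain ⟨σ, hσ, h⟩ := exists_rank_children (m := m) C (by omega)
  have hd := hT.card_le v C fun c hc => (hC c).1 hc
  refine ⟨fun c => ⟨σ c.1, (h c.1 ((hC _).2 c.2)).1.trans_le (min_le_min_left m hd)⟩, ?_, ?_⟩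
  · intro c c' hcc
    exact Subtype.ext (hσ ((hC _).2 c.2) ((hC _).2 c'.2) (by simpa using hcc))
  · exact fun c => (h c.1 ((hC _).2 c.2)).2

/-- Used at a vertex of the path: the child `u'` continuing the path gets the slot `none`, and only
the side branches, of total size at most `m`, are ranked. -/
theorem MaxChildren.exists_rank_of_covBy {d m : ℕ} (hT : T.MaxChildren d) {u u' : T}
    (hu : u ⋖ u') (hs : size u ≤ size u' + (m + 1)) :
    ∃ σ : {c : T // u ⋖ c} → Option (Fin (min m (d - 1))), Function.Injective σ ∧
      (∀ c, σ c = none → c.1 = u') ∧ ∀ c j, σ c = some j → size c.1 ≤ m / (j + 1) := by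
  classical
  let C : Finset T := {c : T | u ⋖ c}.toFinite.toFinset
  have hC : ∀ c, c ∈ C ↔ u ⋖ c := fun c => by simp [C]
  have hsum := sum_size_lt u C fun c hc => (hC c).1 hc
  rw [← Finset.add_sum_erase C size ((hC u').2 hu)] at hsum
  obtain ⟨σ, hσ, h⟩ := exists_rank_children (m := m) (C.erase u') (by omega)
  have hd := hT.card_le u C fun c hc => (hC c).1 hc
  have hd' : (C.erase u').card ≤ d - 1 := by
    rw [Finset.card_erase_of_mem ((hC u').2 hu)]
    omega
  have hmem : ∀ c : {c : T // u ⋖ c}, c.1 ≠ u' → c.1 ∈ C.erase u' := fun c hc =>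
    Finset.mem_erase.2 ⟨hc, (hC _).2 c.2⟩
  let τ : {c : T // u ⋖ c} → Option (Fin (min m (d - 1))) := fun c =>
    if hc : c.1 = u' then none
    else some ⟨σ c.1, (h c.1 (hmem c hc)).1.trans_le (min_le_min_left m hd')⟩
  have hτ : ∀ c (hc : c.1 ≠ u'),
      τ c = some ⟨σ c.1, (h c.1 (hmem c hc)).1.trans_le (min_le_min_left m hd')⟩ :=
    fun c hc => dif_neg hc
  have hτ' : ∀ c, c.1 = u' → τ c = none := fun c hc => dif_pos hc
  refine ⟨τ, ?_, ?_, ?_⟩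
  · intro c c' hcc
    by_cases h1 : c.1 = u' <;> by_cases h2 : c'.1 = u'
    · exact Subtype.ext (h1.trans h2.symm)
    · rw [hτ' c h1, hτ c' h2] at hcc
      exact absurd hcc (by simp)
    · rw [hτ' c' h2, hτ c h1] at hcc
      exact absurd hcc (by simp)
    · rw [hτ c h1, hτ c' h2] at hcc
      exact Subtype.ext (hσ (hmem c h1) (hmem c' h2) (by simpa using hcc))
  · intro c hc
    by_contra h1
    rw [hτ c h1] at hc
    exact absurd hc (by simp)
  · intro c j hj
    by_cases h1 : c.1 = u'
    · rw [hτ' c h1] at hj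
      exact absurd hj (by simp)
    · rw [hτ c h1] at hj
      obtain rfl := Option.some_injective _ hj
      exact (h c.1 (hmem c h1)).2

end Rank

/-! ### Power inequalities that absorb the new root and the rounding -/

section Real

variable {c : ℝ}

theorem natDiv_rpow_le (hc : 0 ≤ c) (m j : ℕ) :
    ((m / (j + 1) : ℕ) : ℝ) ^ c ≤ (m : ℝ) ^ c * ((j + 1 : ℕ) : ℝ) ^ (-c) := by
  rw [Real.rpow_neg (by positivity), ← div_eq_mul_inv,
    ← Real.div_rpow (by positivity) (by positivity)]
  exact Real.rpow_le_rpow (by positivity) Nat.cast_div_le hc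

theorem one_add_mul_rpow_le {B : ℝ} (hc : 1 ≤ c) (hB : 1 ≤ B) (m : ℕ) :
    1 + B * (m : ℝ) ^ c ≤ B * ((m + 1 : ℕ) : ℝ) ^ c := by
  have h : (m : ℝ) ^ c + 1 ≤ ((m + 1 : ℕ) : ℝ) ^ c := by
    have := Real.add_rpow_le_rpow_add (a := (m : ℝ)) (b := 1) (by positivity) zero_le_one hc
    simpa using this
  nlinarith

/-- The increments of `x ^ c` grow by convexity, so the case `n = 2` suffices. This replaces
`one_add_mul_rpow_le` when the coefficient is below `1`. -/
theorem one_le_mul_rpow_sub {A : ℝ} (hc : 1 ≤ c) (hA : 0 ≤ A)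
    (h3 : 1 ≤ A * ((3 : ℝ) ^ c - (2 : ℝ) ^ c)) (n : ℕ) (hn : 2 ≤ n) :
    1 + A * (n : ℝ) ^ c ≤ A * ((n + 1 : ℕ) : ℝ) ^ c := by
  induction n, hn using Nat.le_induction with
  | base => norm_num; linarith
  | succ n hn ih =>
    have hconv := (convexOn_rpow hc).2 (mem_Ici.2 (by positivity : (0 : ℝ) ≤ n))
      (mem_Ici.2 (by positivity : (0 : ℝ) ≤ (n : ℝ) + 2)) (by norm_num : (0 : ℝ) ≤ 1 / 2)
      (by norm_num : (0 : ℝ) ≤ 1 / 2) (by norm_num)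
    have hmid : (1 / 2 : ℝ) • (n : ℝ) + (1 / 2 : ℝ) • ((n : ℝ) + 2) = (n : ℝ) + 1 := by
      simp only [smul_eq_mul]; ring
    rw [hmid] at hconv
    simp only [smul_eq_mul] at hconv
    have h2 : ((n + 1 + 1 : ℕ) : ℝ) = (n : ℝ) + 2 := by push_cast; ring
    rw [h2]
    push_cast at ih ⊢
    nlinarith

end Real

/-! ### Construction of the hosts -/

section Host

variable {d N : ℕ} {c : ℝ} (H : ℕ → RootedTree.{0})

theorem sum_card_le {B : ℝ} (hc : 0 ≤ c) (hB : ∑ j ∈ Finset.range d, ((j + 1 : ℕ) : ℝ) ^ (-c) ≤ B)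
    (hcard : ∀ m, 1 ≤ m → m < N → (Nat.card (H m) : ℝ) ≤ (m : ℝ) ^ c) {m : ℕ} (hm : m < N) :
    ((∑ j : Fin (min m d), Nat.card (H (m / (j + 1))) : ℕ) : ℝ) ≤ B * (m : ℝ) ^ c := by
  rw [Fin.sum_univ_eq_sum_range (fun j => Nat.card (H (m / (j + 1)))), Nat.cast_sum]
  calc ∑ j ∈ Finset.range (min m d), (Nat.card (H (m / (j + 1))) : ℝ)
      ≤ ∑ j ∈ Finset.range (min m d), (m : ℝ) ^ c * ((j + 1 : ℕ) : ℝ) ^ (-c) := by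
        refine Finset.sum_le_sum fun j hj => ?_
        have hj' : j + 1 ≤ m := by have := Finset.mem_range.1 hj; omega
        refine (hcard _ (Nat.div_pos hj' (Nat.succ_pos j)) ?_).trans (natDiv_rpow_le hc m j)
        exact (Nat.div_le_self _ _).trans_lt hm
    _ ≤ ∑ j ∈ Finset.range d, (m : ℝ) ^ c * ((j + 1 : ℕ) : ℝ) ^ (-c) := by
        refine Finset.sum_le_sum_of_subset_of_nonneg
          (Finset.range_mono (min_le_right m d)) fun j _ _ => by positivity
    _ ≤ B * (m : ℝ) ^ c := by
        rw [← Finset.mul_sum, mul_comm]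
        exact mul_le_mul_of_nonneg_right hB (by positivity)

/-- Prolonging a host `X` upwards so that it also hosts a path of total weight `m` that ends in a
vertex hosted by `X`. -/
theorem exists_spine [∀ m, Finite (H m)] {B K : ℝ} (hc : 1 ≤ c) (hB1 : 1 ≤ B)
    (hB : ∑ j ∈ Finset.range (d - 1), ((j + 1 : ℕ) : ℝ) ^ (-c) ≤ B)
    (hK : B + 2 * K * (2 : ℝ) ^ (-c) ≤ K) (hK0 : 0 ≤ K)
    (hcard : ∀ m, 1 ≤ m → m < N → (Nat.card (H m) : ℝ) ≤ (m : ℝ) ^ c)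
    (huniv : ∀ m, 1 ≤ m → m < N → ∀ (T : RootedTree.{u}) [Finite T], T.MaxChildren d → ∀ v : T,
      size v ≤ m → EmbedsAt v (H m))
    (m : ℕ) (hm : m ≤ N) (X : RootedTree.{0}) [Finite X] :
    ∃ Y : RootedTree.{0}, Finite Y ∧ (Nat.card Y : ℝ) ≤ Nat.card X + K * (m : ℝ) ^ c ∧
      ∀ (T : RootedTree.{u}) [Finite T], T.MaxChildren d → ∀ v e : T, v ≤ e →
        size v ≤ size e + m → EmbedsAt e X → EmbedsAt v Y := by
  induction m using Nat.strong_induction_on generalizing X with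
  | _ m ih =>
  rcases Nat.eq_zero_or_pos m with rfl | hm0
  · refine ⟨X, inferInstance, ?_, ?_⟩
    · have : (0 : ℝ) ^ c = 0 := Real.zero_rpow (by linarith)
      simp [this]
    · intro T _ _ v e hve hs he
      rcases hve.eq_or_lt with rfl | h
      · exact he
      · exact absurd (size_lt_of_lt h) (by omega)
  obtain ⟨p, rfl⟩ : ∃ p, m = p + 1 := ⟨m - 1, by omega⟩
  obtain ⟨Z, hZ, hZcard, hZuniv⟩ := ih (p / 2) (by omega) (by omega) X
  -- `none` carries the rest of the path, ending in `X`; the other slots host the side branches of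
  -- the middle vertex.
  let F : Option (Fin (min p (d - 1))) → RootedTree.{0} := fun o =>
    o.elim Z fun j => H (p / (j + 1))
  have hF : ∀ o, Finite (F o) := by
    rintro (_ | j)
    · exact hZ
    · exact inferInstanceAs (Finite (H _))
  -- The upper half is placed on top of `graft F`, so the induction must allow an arbitrary `X`.
  obtain ⟨Y, hY, hYcard, hYuniv⟩ := ih ((p + 1) / 2) (by omega) (by omega) (graft F)
  refine ⟨Y, hY, hYcard.trans ?_, ?_⟩
  · have h1 : (Nat.card (graft F) : ℝ) ≤ 1 + (Nat.card Z + B * (p : ℝ) ^ c) := by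
      rw [card_graft, Fintype.sum_option]
      have := sum_card_le H (by linarith) hB hcard (m := p) (by omega)
      push_cast at this ⊢
      change 1 + ((Nat.card Z : ℝ) + ∑ j : Fin (min p (d - 1)),
        (Nat.card (H (p / (j + 1))) : ℝ)) ≤ _
      linarith
    have half : ∀ q : ℕ, q ≤ p + 1 →
        K * ((q / 2 : ℕ) : ℝ) ^ c ≤ K * (2 : ℝ) ^ (-c) * ((p + 1 : ℕ) : ℝ) ^ c := by
      intro q hq
      have h2 := natDiv_rpow_le (c := c) (by linarith) q 1
      have h3 : (q : ℝ) ^ c ≤ ((p + 1 : ℕ) : ℝ) ^ c :=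
        Real.rpow_le_rpow (by positivity) (by exact_mod_cast hq) (by linarith)
      have h4 : (0 : ℝ) ≤ (2 : ℝ) ^ (-c) := by positivity
      norm_num at h2
      calc K * ((q / 2 : ℕ) : ℝ) ^ c ≤ K * ((q : ℝ) ^ c * (2 : ℝ) ^ (-c)) :=
            mul_le_mul_of_nonneg_left h2 hK0
        _ ≤ K * (((p + 1 : ℕ) : ℝ) ^ c * (2 : ℝ) ^ (-c)) :=
            mul_le_mul_of_nonneg_left (mul_le_mul_of_nonneg_right h3 h4) hK0
        _ = _ := by ring
    have h5 := one_add_mul_rpow_le hc hB1 p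
    have h6 := half p (by omega)
    have h7 := half (p + 1) le_rfl
    have h8 : (0 : ℝ) ≤ ((p + 1 : ℕ) : ℝ) ^ c := by positivity
    have h9 := mul_le_mul_of_nonneg_right hK h8
    linarith
  · intro T _ hT v e hve hs he
    have hfin : {w : T | v ≤ w ∧ w ≤ e ∧ size v ≤ size w + (p + 1) / 2}.Finite := Set.toFinite _
    -- The middle vertex: the last one on the path whose upper part weighs at most `(p + 1) / 2`.
    -- Past its successor `w'`, at most `p / 2` remains, because `p + 1 - ((p + 1) / 2 + 1) = p /
    -- 2`.
    obtain ⟨w, ⟨hvw, hwe, hw⟩, hmax⟩ := hfin.exists_maximal ⟨v, le_rfl, hve, by omega⟩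
    refine hYuniv T hT v w hvw hw ?_
    rcases hwe.eq_or_lt with rfl | hwe
    · exact EmbedsAt.graft F (i := none) (hZuniv T hT w w le_rfl (by omega) he)
    obtain ⟨w', hww', hw'e⟩ := exists_child_le hwe
    have hw' : ¬ size v ≤ size w' + (p + 1) / 2 := fun h =>
      hww'.lt.not_ge (hmax ⟨hvw.trans hww'.le, hw'e, h⟩ hww'.le)
    have hsw := size_anti hvw
    have hse := size_anti hw'e
    obtain ⟨σ, hσ, hnone, hsome⟩ := hT.exists_rank_of_covBy (m := p) hww' (by omega)
    refine EmbedsAt.graft_of_children F σ hσ fun x => ?_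
    rcases hx : σ x with _ | j
    · rw [hnone x hx]
      exact hZuniv T hT w' e hw'e (by omega) he
    · have hj : (j : ℕ) + 1 ≤ p := by have := j.2; omega
      refine huniv _ (Nat.div_pos hj (Nat.succ_pos _)) ?_ T hT x.1 (hsome x j hx)
      exact (Nat.div_le_self _ _).trans_lt (by omega)

end Host

/-- The condition `hlt` is the recursion divided by `n ^ c`: largest child of `e`, its other
children, and the path. The non-strict bound feeds the induction, since for `n = 1` strictness
fails. -/
theorem exists_universal {d : ℕ} {c a A B K : ℝ} (hc : 1 < c) (ha0 : 0 ≤ a) (ha : a < 1 / 2)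
    (hB1 : 1 ≤ B) (hB : ∑ j ∈ Finset.range (d - 1), ((j + 1 : ℕ) : ℝ) ^ (-c) ≤ B)
    (hA : ∑ j ∈ Finset.range (d - 1), ((j + 2 : ℕ) : ℝ) ^ (-c) ≤ A)
    (hA3 : 1 ≤ A * ((3 : ℝ) ^ c - (2 : ℝ) ^ c))
    (hK : B + 2 * K * (2 : ℝ) ^ (-c) ≤ K) (hK0 : 0 ≤ K)
    (hlt : (1 - a) ^ c + A + K * a ^ c < 1) (hd : 1 ≤ d) (n : ℕ) (hn : 1 ≤ n) :
    ∃ S : RootedTree.{0}, Finite S ∧ (Nat.card S : ℝ) ≤ (n : ℝ) ^ c ∧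
      (2 ≤ n → (Nat.card S : ℝ) < (n : ℝ) ^ c) ∧
      ∀ (T : RootedTree.{u}) [Finite T], T.MaxChildren d → ∀ v : T, size v ≤ n → EmbedsAt v S := by
  have hA0 : 0 ≤ A := le_trans (Finset.sum_nonneg fun j _ => by positivity) hA
  induction n using Nat.strong_induction_on with
  | _ n ih =>
  rcases hn.eq_or_lt with rfl | hn2
  · have : ∀ i : Fin 0, Finite ((i.elim0 : RootedTree.{0})) := fun i => i.elim0
    -- Joining the empty family gives the one-vertex tree.
    refine ⟨graft fun i : Fin 0 => (i.elim0 : RootedTree.{0}), inferInstance, ?_, by omega, ?_⟩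
    · rw [card_graft]
      simp
    · intro T _ _ v hv
      have hno : IsEmpty {x : T // v ⋖ x} := ⟨fun x => by
        have h1 := size_lt_of_lt x.2.lt
        have h2 := size_pos x.1
        omega⟩
      exact EmbedsAt.graft_of_children _ isEmptyElim (fun x => isEmptyElim x) isEmptyElim
  have hex : ∀ m, ∃ S : RootedTree.{0}, Finite S ∧ (1 ≤ m → m < n →
      (Nat.card S : ℝ) ≤ (m : ℝ) ^ c ∧ ∀ (T : RootedTree.{u}) [Finite T], T.MaxChildren d →
        ∀ v : T, size v ≤ m → EmbedsAt v S) := by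
    intro m
    by_cases h : 1 ≤ m ∧ m < n
    · obtain ⟨S, h1, h2, -, h3⟩ := ih m h.2 h.1
      exact ⟨S, h1, fun _ _ => ⟨h2, h3⟩⟩
    · obtain ⟨S, h1, -⟩ := ih 1 hn2 le_rfl
      exact ⟨S, h1, fun h1 h2 => absurd ⟨h1, h2⟩ h⟩
  choose H hfin hH using hex
  have hcard := fun m h1 h2 => (hH m h1 h2).1
  have huniv := fun m h1 h2 => (hH m h1 h2).2
  set k := ⌊a * n⌋₊ with hk
  have hn0 : (2 : ℝ) ≤ n := by exact_mod_cast hn2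
  have han : 0 ≤ a * n := by positivity
  have hk1 : (k : ℝ) ≤ a * n := Nat.floor_le han
  have hk2 : a * n < k + 1 := Nat.lt_floor_add_one _
  have hkn : 2 * k < n := by
    have : (2 * k : ℝ) < n := by nlinarith
    exact_mod_cast this
  obtain ⟨r, hr⟩ : ∃ r, min (n - 1) d = r + 1 := ⟨min (n - 1) d - 1, by omega⟩
  -- For rank `0` the ranking only gives `n - 1`; the choice of `e` improves it to `n - k - 1`.
  let F : Fin (min (n - 1) d) → RootedTree.{0} := fun j =>
    H (if j.1 = 0 then n - k - 1 else (n - 1) / (j + 1))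
  obtain ⟨Y, hY, hYcard, hYuniv⟩ := exists_spine H hc.le hB1 hB hK hK0 hcard huniv k
    (by omega) (graft F)
  have hFcard : (Nat.card (graft F) : ℝ) ≤ 1 + ((n - k - 1 : ℕ) : ℝ) ^ c +
      ∑ j ∈ Finset.range r, ((n - 1 : ℕ) : ℝ) ^ c * ((j + 2 : ℕ) : ℝ) ^ (-c) := by
    rw [card_graft, Fin.sum_univ_eq_sum_range
      (fun j => Nat.card (H (if j = 0 then n - k - 1 else (n - 1) / (j + 1)))), hr,
      Finset.sum_range_succ']
    push_cast
    have h1 := hcard (n - k - 1) (by omega) (by omega)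
    have h2 : ∑ j ∈ Finset.range r, (Nat.card (H (if j + 1 = 0 then n - k - 1 else
        (n - 1) / (j + 1 + 1))) : ℝ) ≤
        ∑ j ∈ Finset.range r, ((n - 1 : ℕ) : ℝ) ^ c * ((j + 2 : ℕ) : ℝ) ^ (-c) := by
      refine Finset.sum_le_sum fun j hj => ?_
      have hj' := Finset.mem_range.1 hj
      rw [if_neg (Nat.succ_ne_zero j)]
      refine (hcard _ (Nat.div_pos (by omega) (Nat.succ_pos _)) ?_).trans
        (natDiv_rpow_le (by linarith) (n - 1) (j + 1))
      exact (Nat.div_le_self _ _).trans_lt (by omega)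
    push_cast at h2
    linarith
  have hlt' : (Nat.card Y : ℝ) < (n : ℝ) ^ c := by
    replace hYcard := hYcard.trans (add_le_add hFcard le_rfl)
    clear hFcard hYuniv
    -- The case `n = 2` is separate because `one_le_mul_rpow_sub` needs `2 ≤ n - 1`; here the host
    -- has at most two vertices and `2 < 2 ^ c`.
    rcases (Nat.succ_le_of_lt hn2).eq_or_lt with hn2' | hn3
    · have hn2'' : n = 2 := by omega
      have hk0 : k = 0 := by omega
      have hr0 : r = 0 := by omega
      rw [hr0, hk0, hn2'', Nat.cast_zero, Real.zero_rpow (by linarith)] at hYcard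
      have h2c : (2 : ℝ) < (2 : ℝ) ^ c := Real.self_lt_rpow_of_one_lt (by norm_num) hc
      rw [hn2'']
      norm_num at hYcard ⊢
      exact lt_of_le_of_lt (by exact_mod_cast hYcard) h2c
    · obtain ⟨q, rfl⟩ : ∃ q, n = q + 1 := ⟨n - 1, by omega⟩
      have h1 : ∑ j ∈ Finset.range r, (q : ℝ) ^ c * ((j + 2 : ℕ) : ℝ) ^ (-c) ≤ A * (q : ℝ) ^ c := by
        rw [← Finset.mul_sum, mul_comm]
        refine mul_le_mul_of_nonneg_right (le_trans ?_ hA) (by positivity)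
        exact Finset.sum_le_sum_of_subset_of_nonneg (Finset.range_mono (by omega))
          fun j _ _ => by positivity
      have h2 := one_le_mul_rpow_sub hc.le hA0 hA3 q (by omega)
      have h3 : (k : ℝ) ^ c ≤ a ^ c * ((q + 1 : ℕ) : ℝ) ^ c := by
        rw [← Real.mul_rpow ha0 (by positivity)]
        exact Real.rpow_le_rpow (by positivity) hk1 (by linarith)
      have h4 : ((q + 1 - k - 1 : ℕ) : ℝ) ^ c ≤ (1 - a) ^ c * ((q + 1 : ℕ) : ℝ) ^ c := by
        rw [← Real.mul_rpow (by linarith) (by positivity)]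
        refine Real.rpow_le_rpow (by positivity) ?_ (by linarith)
        have : ((q + 1 - k - 1 : ℕ) : ℝ) + (k + 1) = ((q + 1 : ℕ) : ℝ) := by
          have : q + 1 - k - 1 + (k + 1) = q + 1 := by omega
          exact_mod_cast this
        linarith
      have h5 : (0 : ℝ) < ((q + 1 : ℕ) : ℝ) ^ c := by positivity
      have h6 := mul_lt_mul_of_pos_right hlt h5
      have h7 := mul_le_mul_of_nonneg_left h3 hK0
      rw [Nat.add_sub_cancel] at hYcard
      linarith
  refine ⟨Y, hY, hlt'.le, fun _ => hlt', ?_⟩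
  intro T _ hT v hv
  have hfinset : {w : T | v ≤ w ∧ size v ≤ size w + k}.Finite := Set.toFinite _
  -- By maximality, every child of `e` has size less than `size v - k`.
  obtain ⟨e, ⟨hve, he⟩, hmax⟩ := hfinset.exists_maximal ⟨v, le_rfl, by omega⟩
  refine hYuniv T hT v e hve he ?_
  have hse := size_anti hve
  obtain ⟨σ, hσ, hrank⟩ := hT.exists_rank (m := n - 1) (v := e) (by omega)
  refine EmbedsAt.graft_of_children F σ hσ fun x => ?_
  have hx : ¬ size v ≤ size x.1 + k := fun h =>
    x.2.lt.not_ge (hmax ⟨hve.trans x.2.le, h⟩ x.2.le)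
  have hj : (σ x : ℕ) + 1 ≤ n - 1 := by have := (σ x).2; omega
  change EmbedsAt x.1 (H (if (σ x).1 = 0 then _ else _))
  split_ifs with h0
  · exact huniv _ (by omega) (by omega) T hT x.1 (by omega)
  · refine huniv _ (Nat.div_pos hj (Nat.succ_pos _)) ?_ T hT x.1 (hrank x)
    exact (Nat.div_le_self _ _).trans_lt (by omega)

/-! ### Numerical bounds for powers and for the zeta tail -/

/-- An upper bound for a rational power by a comparison of natural powers. -/
theorem rpow_lt_of_pow_lt {x y : ℝ} (hx : 0 ≤ x) (hy : 0 ≤ y) {p q : ℕ} (hq : q ≠ 0)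
    (h : x ^ p < y ^ q) : x ^ ((p : ℝ) / q) < y := by
  rw [← Real.rpow_natCast, ← Real.rpow_natCast] at h
  have hq' : (0 : ℝ) < q := by positivity
  have h1 := Real.rpow_lt_rpow (by positivity) h (inv_pos.2 hq')
  rwa [← Real.rpow_mul hx, ← Real.rpow_mul hy, mul_inv_cancel₀ hq'.ne', Real.rpow_one,
    ← div_eq_mul_inv] at h1

theorem lt_rpow_of_pow_lt {x y : ℝ} (hx : 0 ≤ x) (hy : 0 ≤ y) {p q : ℕ} (hq : q ≠ 0)
    (h : y ^ q < x ^ p) : y < x ^ ((p : ℝ) / q) := by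
  rw [← Real.rpow_natCast, ← Real.rpow_natCast] at h
  have hq' : (0 : ℝ) < q := by positivity
  have h1 := Real.rpow_lt_rpow (by positivity) h (inv_pos.2 hq')
  rwa [← Real.rpow_mul hx, ← Real.rpow_mul hy, mul_inv_cancel₀ hq'.ne', Real.rpow_one,
    ← div_eq_mul_inv] at h1

theorem inv_le_log_div {t : ℝ} (ht : 1 / 2 < t) :
    1 / t ≤ Real.log ((t + 1 / 2) / (t - 1 / 2)) := by
  obtain ⟨s, rfl⟩ : ∃ s, t = s + 1 / 2 := ⟨t - 1 / 2, by ring⟩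
  have hs : 0 < s := by linarith
  have h := Real.le_log_one_add_of_nonneg (x := 1 / s) (by positivity)
  have e1 : 2 * (1 / s) / (1 / s + 2) = 1 / (s + 1 / 2) := by
    field_simp
    ring
  have e2 : 1 + 1 / s = (s + 1 / 2 + 1 / 2) / (s + 1 / 2 - 1 / 2) := by
    rw [add_sub_cancel_right]
    field_simp
    ring
  rwa [e1, e2] at h

/-- The midpoint rule underestimates the integral of the convex function `t ^ (-(p + 1))`. -/
theorem mul_rpow_le_sub {p t : ℝ} (hp : 0 < p) (ht : 1 / 2 < t) :
    p * t ^ (-(p + 1)) ≤ (t - 1 / 2) ^ (-p) - (t + 1 / 2) ^ (-p) := by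
  have h0 : 0 < t - 1 / 2 := by linarith
  have h1 : 0 < t + 1 / 2 := by linarith
  have ht0 : 0 < t := by linarith
  -- With `M` the mean of the logarithms of the endpoints, the right side is `2 * exp (-p * M) *
  -- sinh (p * L / 2)`. It remains to use `x ≤ sinh x`, `1 / t ≤ L` and `M ≤ log t`.
  set L := Real.log ((t + 1 / 2) / (t - 1 / 2)) with hL
  have hLt : 1 / t ≤ L := inv_le_log_div ht
  have hL0 : 0 < L := lt_of_lt_of_le (by positivity) hLt
  have hL' : L = Real.log (t + 1 / 2) - Real.log (t - 1 / 2) := Real.log_div h1.ne' h0.ne'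
  set M := (Real.log (t + 1 / 2) + Real.log (t - 1 / 2)) / 2 with hM
  have hMt : M ≤ Real.log t := by
    have : Real.log ((t + 1 / 2) * (t - 1 / 2)) ≤ Real.log (t ^ 2) :=
      Real.log_le_log (by positivity) (by nlinarith)
    rw [Real.log_mul h1.ne' h0.ne', Real.log_pow] at this
    push_cast at this
    linarith
  have e1 : (t - 1 / 2) ^ (-p) = Real.exp (-p * M) * Real.exp (p * L / 2) := by
    rw [Real.rpow_def_of_pos h0, ← Real.exp_add]
    congr 1
    rw [hM, hL']
    ring
  have e2 : (t + 1 / 2) ^ (-p) = Real.exp (-p * M) * Real.exp (-(p * L / 2)) := by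
    rw [Real.rpow_def_of_pos h1, ← Real.exp_add]
    congr 1
    rw [hM, hL']
    ring
  have e3 : t ^ (-(p + 1)) = Real.exp (-p * Real.log t) * (1 / t) := by
    rw [neg_add, Real.rpow_add ht0, Real.rpow_neg_one, Real.rpow_def_of_pos ht0, one_div]
    ring_nf
  have hsinh : p * L ≤ Real.exp (p * L / 2) - Real.exp (-(p * L / 2)) := by
    have := Real.self_le_sinh_iff.2 (show 0 ≤ p * L / 2 by positivity)
    rw [Real.sinh_eq] at this
    linarith
  have hexp : Real.exp (-p * Real.log t) ≤ Real.exp (-p * M) := Real.exp_le_exp.2 (by nlinarith)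
  rw [e1, e2, e3, ← mul_sub]
  calc p * (Real.exp (-p * Real.log t) * (1 / t))
      = Real.exp (-p * Real.log t) * (p * (1 / t)) := by ring
    _ ≤ Real.exp (-p * M) * (p * L) := by gcongr
    _ ≤ _ := mul_le_mul_of_nonneg_left hsinh (Real.exp_pos _).le

theorem sum_rpow_tail_le {p : ℝ} (hp : 0 < p) (s k : ℕ) (hs : 1 ≤ s) :
    ∑ j ∈ Finset.range k, ((j + s : ℕ) : ℝ) ^ (-(p + 1)) ≤ ((s : ℝ) - 1 / 2) ^ (-p) / p := by
  have hs' : (1 : ℝ) ≤ s := by exact_mod_cast hs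
  rw [le_div_iff₀ hp]
  suffices h : (∑ j ∈ Finset.range k, ((j + s : ℕ) : ℝ) ^ (-(p + 1))) * p ≤
      ((s : ℝ) - 1 / 2) ^ (-p) - ((k : ℝ) + s - 1 / 2) ^ (-p) by
    have : 0 ≤ ((k : ℝ) + s - 1 / 2) ^ (-p) :=
      Real.rpow_nonneg (by have : (0 : ℝ) ≤ k := by positivity
                           linarith) _
    linarith
  induction k with
  | zero => simp
  | succ k ih =>
    have hk : (0 : ℝ) ≤ k := by positivity
    have h := mul_rpow_le_sub hp (t := ((k + s : ℕ) : ℝ)) (by push_cast; linarith)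
    rw [Finset.sum_range_succ, add_mul]
    push_cast at ih h ⊢
    have e : (k : ℝ) + 1 + s - 1 / 2 = k + s + 1 / 2 := by ring
    rw [e]
    linarith

theorem rpow_neg_lt_of_pow_lt {x y : ℝ} (hx : 0 ≤ x) (hy : 0 ≤ y) {p q : ℕ} (hq : q ≠ 0)
    (h : x⁻¹ ^ p < y ^ q) : x ^ (-((p : ℝ) / q)) < y := by
  rw [Real.rpow_neg hx, ← Real.inv_rpow hx]
  exact rpow_lt_of_pow_lt (inv_nonneg.2 hx) hy hq h

-- The terms with bases `2` to `8` are bounded one by one, and the tail from `9` by the integral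
-- from `17 / 2`.
set_option exponentiation.threshold 2000 in
theorem sum_rpow_neg_le (k : ℕ) :
    ∑ j ∈ Finset.range k, ((j + 2 : ℕ) : ℝ) ^ (-((1159 : ℕ) / (500 : ℕ) : ℝ)) ≤ 0.42312 := by
  have hsub : ∑ j ∈ Finset.range k, ((j + 2 : ℕ) : ℝ) ^ (-((1159 : ℕ) / (500 : ℕ) : ℝ)) ≤
      ∑ j ∈ Finset.range (7 + k), ((j + 2 : ℕ) : ℝ) ^ (-((1159 : ℕ) / (500 : ℕ) : ℝ)) :=
    Finset.sum_le_sum_of_subset_of_nonneg (Finset.range_mono (by omega))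
      fun j _ _ => by positivity
  have htail : ∑ j ∈ Finset.range k, ((7 + j + 2 : ℕ) : ℝ) ^ (-((1159 : ℕ) / (500 : ℕ) : ℝ)) ≤
      0.05958 / 1.318 := by
    have h1 := sum_rpow_tail_le (p := (659 : ℕ) / (500 : ℕ)) (by norm_num) 9 k (by norm_num)
    have h2 : ((17 : ℝ) / 2) ^ (-((659 : ℕ) / (500 : ℕ) : ℝ)) < 0.05958 :=
      rpow_neg_lt_of_pow_lt (by norm_num) (by norm_num) (by norm_num) (by norm_num)
    have e1 : (((9 : ℕ) : ℝ) - 1 / 2) = 17 / 2 := by norm_num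
    have e2 : -(((659 : ℕ) : ℝ) / (500 : ℕ) + 1) = -(((1159 : ℕ) : ℝ) / (500 : ℕ)) := by norm_num
    rw [e1, e2] at h1
    have e3 : ∀ j : ℕ, 7 + j + 2 = j + 9 := fun j => by omega
    simp only [e3]
    refine h1.trans ?_
    have e4 : ((659 : ℕ) : ℝ) / (500 : ℕ) = 1.318 := by norm_num
    rw [e4] at h2 ⊢
    exact div_le_div_of_nonneg_right h2.le (by norm_num)
  have t2 : (2 : ℝ) ^ (-((1159 : ℕ) / (500 : ℕ) : ℝ)) < 0.20055 :=
    rpow_neg_lt_of_pow_lt (by norm_num) (by norm_num) (by norm_num) (by norm_num)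
  have t3 : (3 : ℝ) ^ (-((1159 : ℕ) / (500 : ℕ) : ℝ)) < 0.07836 :=
    rpow_neg_lt_of_pow_lt (by norm_num) (by norm_num) (by norm_num) (by norm_num)
  have t4 : (4 : ℝ) ^ (-((1159 : ℕ) / (500 : ℕ) : ℝ)) < 0.04023 :=
    rpow_neg_lt_of_pow_lt (by norm_num) (by norm_num) (by norm_num) (by norm_num)
  have t5 : (5 : ℝ) ^ (-((1159 : ℕ) / (500 : ℕ) : ℝ)) < 0.02398 :=
    rpow_neg_lt_of_pow_lt (by norm_num) (by norm_num) (by norm_num) (by norm_num)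
  have t6 : (6 : ℝ) ^ (-((1159 : ℕ) / (500 : ℕ) : ℝ)) < 0.01572 :=
    rpow_neg_lt_of_pow_lt (by norm_num) (by norm_num) (by norm_num) (by norm_num)
  have t7 : (7 : ℝ) ^ (-((1159 : ℕ) / (500 : ℕ) : ℝ)) < 0.011 :=
    rpow_neg_lt_of_pow_lt (by norm_num) (by norm_num) (by norm_num) (by norm_num)
  have t8 : (8 : ℝ) ^ (-((1159 : ℕ) / (500 : ℕ) : ℝ)) < 0.00807 :=
    rpow_neg_lt_of_pow_lt (by norm_num) (by norm_num) (by norm_num) (by norm_num)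
  refine hsub.trans ?_
  rw [Finset.sum_range_add]
  refine (add_le_add le_rfl htail).trans ?_
  generalize -(((1159 : ℕ) : ℝ) / (500 : ℕ)) = e at t2 t3 t4 t5 t6 t7 t8 ⊢
  simp only [Finset.sum_range_succ, Finset.sum_range_zero]
  norm_num at t2 t3 t4 t5 t6 t7 t8 ⊢
  linarith

/-! ### The two exponents -/

set_option exponentiation.threshold 2000 in
theorem exists_universal_of_le {d n : ℕ} (hd : 1 ≤ d) (hn : 2 ≤ n) :
    ∃ S : RootedTree.{0}, Finite S ∧ (Nat.card S : ℝ) < (n : ℝ) ^ (2.318 : ℝ) ∧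
      ∀ (T : RootedTree.{u}) [Finite T], T.MaxChildren d → ∀ v : T, size v ≤ n → EmbedsAt v S := by
  have hc : (2.318 : ℝ) = ((1159 : ℕ) : ℝ) / (500 : ℕ) := by norm_num
  have t2 : (2 : ℝ) ^ (-((1159 : ℕ) / (500 : ℕ) : ℝ)) < 0.20055 :=
    rpow_neg_lt_of_pow_lt (by norm_num) (by norm_num) (by norm_num) (by norm_num)
  have u2 : (2 : ℝ) ^ ((1159 : ℕ) / (500 : ℕ) : ℝ) < 5 :=
    rpow_lt_of_pow_lt (by norm_num) (by norm_num) (by norm_num) (by norm_num)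
  have u3 : 12 < (3 : ℝ) ^ ((1159 : ℕ) / (500 : ℕ) : ℝ) :=
    lt_rpow_of_pow_lt (by norm_num) (by norm_num) (by norm_num) (by norm_num)
  have ua : (1 - 0.34 : ℝ) ^ ((1159 : ℕ) / (500 : ℕ) : ℝ) < 0.38169 :=
    rpow_lt_of_pow_lt (by norm_num) (by norm_num) (by norm_num) (by norm_num)
  have ub : (0.34 : ℝ) ^ ((1159 : ℕ) / (500 : ℕ) : ℝ) < 0.08204 :=
    rpow_lt_of_pow_lt (by norm_num) (by norm_num) (by norm_num) (by norm_num)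
  have hB : ∑ j ∈ Finset.range (d - 1), ((j + 1 : ℕ) : ℝ) ^ (-((1159 : ℕ) / (500 : ℕ) : ℝ)) ≤
      1.42312 := by
    refine le_trans (Finset.sum_le_sum_of_subset_of_nonneg
      (Finset.range_mono (Nat.le_succ (d - 1))) fun j _ _ => by positivity) ?_
    rw [Finset.sum_range_succ', zero_add, Nat.cast_one, Real.one_rpow]
    have h : ∑ j ∈ Finset.range (d - 1),
        ((j + 1 + 1 : ℕ) : ℝ) ^ (-((1159 : ℕ) / (500 : ℕ) : ℝ)) ≤ 0.42312 :=
      sum_rpow_neg_le (d - 1)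
    linarith
  rw [hc]
  -- `K` is `B / (1 - 2 * 0.20055)` rounded up, and `a` leaves the sum in `hlt` just below `1`.
  obtain ⟨S, h1, -, h2, h3⟩ := exists_universal.{u} (d := d) (c := (1159 : ℕ) / (500 : ℕ))
    (a := 0.34) (A := 0.42312) (B := 1.42312) (K := 2.3763) (by norm_num) (by norm_num)
    (by norm_num) (by norm_num) hB (sum_rpow_neg_le (d - 1)) (by linarith) (by linarith)
    (by norm_num) (by linarith) hd n (by omega)
  exact ⟨S, h1, h2 hn, h3⟩

set_option exponentiation.threshold 2000 in
theorem exists_universal_binary {n : ℕ} (hn : 2 ≤ n) :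
    ∃ S : RootedTree.{0}, Finite S ∧ (Nat.card S : ℝ) < (n : ℝ) ^ (1.894 : ℝ) ∧
      ∀ (T : RootedTree.{u}) [Finite T], T.MaxChildren 2 → ∀ v : T, size v ≤ n → EmbedsAt v S := by
  have hc : (1.894 : ℝ) = ((947 : ℕ) : ℝ) / (500 : ℕ) := by norm_num
  have t2 : (2 : ℝ) ^ (-((947 : ℕ) / (500 : ℕ) : ℝ)) < 0.26907 :=
    rpow_neg_lt_of_pow_lt (by norm_num) (by norm_num) (by norm_num) (by norm_num)
  have u2 : (2 : ℝ) ^ ((947 : ℕ) / (500 : ℕ) : ℝ) < 4 :=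
    rpow_lt_of_pow_lt (by norm_num) (by norm_num) (by norm_num) (by norm_num)
  have u3 : 8 < (3 : ℝ) ^ ((947 : ℕ) / (500 : ℕ) : ℝ) :=
    lt_rpow_of_pow_lt (by norm_num) (by norm_num) (by norm_num) (by norm_num)
  have ua : (1 - 0.3 : ℝ) ^ ((947 : ℕ) / (500 : ℕ) : ℝ) < 0.50889 :=
    rpow_lt_of_pow_lt (by norm_num) (by norm_num) (by norm_num) (by norm_num)
  have ub : (0.3 : ℝ) ^ ((947 : ℕ) / (500 : ℕ) : ℝ) < 0.10226 :=
    rpow_lt_of_pow_lt (by norm_num) (by norm_num) (by norm_num) (by norm_num)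
  rw [hc]
  -- With two children the sums have one term each, `1` for `B` and `2 ^ (-c)` for `A`.
  obtain ⟨S, h1, -, h2, h3⟩ := exists_universal.{u} (d := 2) (c := (947 : ℕ) / (500 : ℕ))
    (a := 0.3) (A := 0.26907) (B := 1) (K := 2.1652) (by norm_num) (by norm_num)
    (by norm_num) (by norm_num) (by simp) (by simpa using t2.le) (by linarith) (by linarith)
    (by norm_num) (by linarith) (by norm_num) n (by omega)
  exact ⟨S, h1, h2 hn, h3⟩

theorem EmbedsAt.exists_of_bot {T : RootedTree.{u}} {S : RootedTree.{0}}
    (h : EmbedsAt (⊥ : T) S) : ∃ φ : T → S, Function.Injective φ ∧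
      ∀ a b : T, φ (T.nca a b) = S.nca (φ a) (φ b) := by
  obtain ⟨φ, hinj, hφ⟩ := h
  exact ⟨φ, fun a b hab => hinj bot_le bot_le hab, fun a b => hφ a b bot_le bot_le⟩

theorem size_bot (T : RootedTree.{u}) : size (⊥ : T) = Nat.card T := by
  rw [size, Ici_bot, Set.ncard_univ]

theorem maxChildren_of_card_le {T : RootedTree.{u}} [Finite T] {n : ℕ} (h : Nat.card T ≤ n) :
    T.MaxChildren n := by
  intro a
  rw [← Set.Finite.cast_ncard_eq (Set.toFinite _)]
  exact_mod_cast (Set.ncard_le_card _).trans h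

end RootedTree

theorem mainTheorem1 (n : ℕ) (hn : 2 ≤ n) :
    (∃ S : RootedTree.{0}, Finite S ∧ (Nat.card S : ℝ) < (n : ℝ) ^ (2.318 : ℝ) ∧
      S.IsNCAUniversal (RootedTree.trees.{u} n)) ∧
    (∃ S : RootedTree.{0}, Finite S ∧ (Nat.card S : ℝ) < (n : ℝ) ^ (1.894 : ℝ) ∧
      S.IsNCAUniversal (RootedTree.binaryTrees.{u} n)) := by
  constructor
  · obtain ⟨S, hfin, hcard, h⟩ := RootedTree.exists_universal_of_le.{u} (d := n) (by omega) hn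
    refine ⟨S, hfin, hcard, ?_⟩
    rintro T ⟨hT, hTn⟩
    exact (h T (RootedTree.maxChildren_of_card_le hTn) ⊥
      ((RootedTree.size_bot T).trans_le hTn)).exists_of_bot
  · obtain ⟨S, hfin, hcard, h⟩ := RootedTree.exists_universal_binary.{u} hn
    refine ⟨S, hfin, hcard, ?_⟩
    rintro T ⟨hT, hTn, hbin⟩
    exact (h T hbin ⊥ ((RootedTree.size_bot T).trans_le hTn)).exists_of_bot
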